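/- Let $H_1$ and $H_2$ be (real or complex) Hilbert spaces, and let $S\colon H_1\to H_2$ and $T\colon H_2\to H_1$ be bounded linear operators such that the ranges $R(TS)\subseteq H_1$ and $R(ST)\subseteq H_2$ are finite dimensional. Call $(S,T)$ a Fredholm pair if the four spaces $$N(S)/(N(S)\cap R(T)),\quad R(T)/(N(S)\cap R(T)),\quad N(T)/(N(T)\cap R(S)),\quad R(S)/(N(T)\cap R(S))$$ are finite dimensional, where $N(\cdot)$ and $R(\cdot)$ denote the null space and the range. Let $H=H_1\oplus H_2$ be the orthogonal direct sum, let $U=\begin{pmatrix}0&T\\ S&0\end{pmatrix}$, a bounded linear operator on $H$, and let $V=U+U^*$. Then the following statements are equivalent: 1. $(S,T)$ is a Fredholm pair; 2. $V$ is a Fredholm operator; 3. $V^2$ is a Fredholm operator; 4. $UU^*+U^*U$ is a Fredholm operator; 5. $TT^*+S^*S$ (on $H_1$) and $SS^*+T^*T$ (on $H_2$) are both Fredholm operators. -/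

import Mathlib

/-- `(S, T)` is a Fredholm pair: the four quotients `N(S)/(N(S) ∩ R(T))`, `R(T)/(N(S) ∩ R(T))`,
`N(T)/(N(T) ∩ R(S))` and `R(S)/(N(T) ∩ R(S))` are finite dimensional. -/
structure IsFredholmPair {𝕜 H₁ H₂ : Type*} [RCLike 𝕜]
    [NormedAddCommGroup H₁] [InnerProductSpace 𝕜 H₁]
    [NormedAddCommGroup H₂] [InnerProductSpace 𝕜 H₂]
    (S : H₁ →L[𝕜] H₂) (T : H₂ →L[𝕜] H₁) : Prop where
  finite_ker_fst : FiniteDimensional 𝕜 (S.ker ⧸ (S.ker ⊓ T.range).submoduleOf S.ker)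
  finite_range_snd : FiniteDimensional 𝕜 (T.range ⧸ (S.ker ⊓ T.range).submoduleOf T.range)
  finite_ker_snd : FiniteDimensional 𝕜 (T.ker ⧸ (T.ker ⊓ S.range).submoduleOf T.ker)
  finite_range_fst : FiniteDimensional 𝕜 (S.range ⧸ (T.ker ⊓ S.range).submoduleOf S.range)

/-- The operator matrix `[[0, T], [S, 0]]`, i.e. `(x, y) ↦ (T y, S x)`, on the orthogonal
(Hilbert) direct sum `H₁ ⊕ H₂`. -/
noncomputable def offDiag {𝕜 H₁ H₂ : Type*} [RCLike 𝕜]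
    [NormedAddCommGroup H₁] [InnerProductSpace 𝕜 H₁]
    [NormedAddCommGroup H₂] [InnerProductSpace 𝕜 H₂]
    (S : H₁ →L[𝕜] H₂) (T : H₂ →L[𝕜] H₁) :
    WithLp 2 (H₁ × H₂) →L[𝕜] WithLp 2 (H₁ × H₂) :=
  (WithLp.prodContinuousLinearEquiv 2 𝕜 H₁ H₂).symm.toContinuousLinearMap ∘L
    ((T ∘L WithLp.sndL 2 𝕜 H₁ H₂).prod (S ∘L WithLp.fstL 2 𝕜 H₁ H₂))

theorem offDiag_apply {𝕜 H₁ H₂ : Type*} [RCLike 𝕜]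
    [NormedAddCommGroup H₁] [InnerProductSpace 𝕜 H₁]
    [NormedAddCommGroup H₂] [InnerProductSpace 𝕜 H₂]
    (S : H₁ →L[𝕜] H₂) (T : H₂ →L[𝕜] H₁) (x : H₁) (y : H₂) :
    offDiag S T (WithLp.toLp 2 (x, y)) = WithLp.toLp 2 (T y, S x) := rfl

/-! Work in the ring of bounded operators modulo finite rank, where Fredholm means invertible
(`isFredholm_iff_isUnit`). Write u, u' for the classes of U and U*. Since ST and TS have finite
rank, u² = u'² = 0, so V² has class d = uu' + u'u; as a square is a unit exactly when its root is,
the statements on V, V² and UU* + U*U agree. The last operator is block diagonal, which gives the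
two operators on H₁ and H₂.

Being a Fredholm pair amounts to N(U) ⊆ R(U) + F with F finite dimensional (`isFredholmPair_iff`).
If d is invertible, its inverse yields a homotopy formula that puts N(U) in R(U) up to finite
dimension (`ker_le_range_sup_of_isUnit`). Conversely, the inclusion provides a partial inverse w of
u, and w + w' inverts u + u' (`isUnit_add_adjoint_of_ker_le`). -/

open ContinuousLinearMap

/-! ### Inclusions and quotients up to finite dimension -/

section Submodules

variable {K V V₂ : Type*} [Field K] [AddCommGroup V] [Module K V] [AddCommGroup V₂] [Module K V₂]

theorem Submodule.finite_quotient_inf_iff (A B : Submodule K V) :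
    FiniteDimensional K (A ⧸ (A ⊓ B).submoduleOf A) ↔
      ∃ F : Submodule K V, F.FG ∧ A ≤ B ⊔ F := by
  constructor
  · intro h
    obtain ⟨G, hG⟩ := Submodule.exists_isCompl ((A ⊓ B).submoduleOf A)
    refine ⟨G.map A.subtype, (Submodule.CoFG.fg_of_isCompl hG h).map _, fun x hx ↦ ?_⟩
    have hx' : (⟨x, hx⟩ : A) ∈ (A ⊓ B).submoduleOf A ⊔ G := by simp [hG.sup_eq_top]
    obtain ⟨y, hy, z, hz, hyz⟩ := Submodule.mem_sup.1 hx'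
    exact Submodule.mem_sup.2 ⟨y, (Submodule.mem_comap.1 hy).2, z,
      Submodule.mem_map_of_mem hz, congrArg Subtype.val hyz⟩
  · rintro ⟨F, hF, hAB⟩
    have hker : (A ⊓ B).submoduleOf A = (B.mkQ ∘ₗ A.subtype).ker := by
      ext x
      simp [Submodule.submoduleOf]
    rw [hker]
    refine LinearMap.ker_coFG_iff_hasFiniteRange.2 ?_
    have : Module.Finite K (F.map B.mkQ) := Module.Finite.iff_fg.2 (hF.map _)
    have hle : (B.mkQ ∘ₗ A.subtype).range ≤ F.map B.mkQ := by
      rintro _ ⟨x, rfl⟩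
      obtain ⟨y, hy, z, hz, hyz⟩ := Submodule.mem_sup.1 (hAB x.2)
      refine ⟨z, hz, ?_⟩
      simp only [LinearMap.comp_apply, Submodule.subtype_apply, ← hyz, map_add]
      simpa using hy
    exact Module.Finite.iff_fg.1 (Submodule.finiteDimensional_of_le hle)

/-- The quotient is isomorphic to f(B). With B = R(T) and f = S, or the reverse, two of the four
conditions on a Fredholm pair become automatic. -/
theorem LinearMap.finite_quotient_ker_inf (f : V →ₗ[K] V₂) (B : Submodule K V)
    (h : FiniteDimensional K (B.map f)) :
    FiniteDimensional K (B ⧸ (f.ker ⊓ B).submoduleOf B) := by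
  have hker : (f.ker ⊓ B).submoduleOf B = (f ∘ₗ B.subtype).ker := by
    ext x
    simp [Submodule.submoduleOf]
  rw [hker]
  refine LinearMap.ker_coFG_iff_hasFiniteRange.2 ?_
  rw [LinearMap.hasFiniteRange_iff_range, LinearMap.range_comp, Submodule.range_subtype]
  exact Module.Finite.iff_fg.1 h

end Submodules

/-! ### Bounded operators modulo finite rank -/

section FiniteRank

variable {𝕜 H : Type*} [RCLike 𝕜] [NormedAddCommGroup H] [InnerProductSpace 𝕜 H]

variable (𝕜 H) in
/-- The two-sided ideal of finite rank operators in the ring of bounded operators. -/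
def finiteRankIdeal : Ideal (H →L[𝕜] H) where
  carrier := {A | A.toLinearMap.HasFiniteRange}
  add_mem' hA hB := LinearMap.HasFiniteRange.add hA hB
  zero_mem' := LinearMap.HasFiniteRange.zero
  smul_mem' C _ hA := LinearMap.HasFiniteRange.comp_left hA C.toLinearMap

instance : (finiteRankIdeal 𝕜 H).IsTwoSided where
  mul_mem_of_left C hA := LinearMap.HasFiniteRange.comp_right hA C.toLinearMap

variable (𝕜 H) in
/-- The ring of bounded operators modulo finite rank operators. -/
abbrev ModFiniteRank : Type _ := (H →L[𝕜] H) ⧸ finiteRankIdeal 𝕜 H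

/-- The class of a bounded operator modulo finite rank operators. -/
abbrev modFiniteRank : (H →L[𝕜] H) →+* ModFiniteRank 𝕜 H :=
  Ideal.Quotient.mk (finiteRankIdeal 𝕜 H)

theorem modFiniteRank_eq_iff {A B : H →L[𝕜] H} :
    modFiniteRank A = modFiniteRank B ↔ (A - B).toLinearMap.HasFiniteRange :=
  Ideal.Quotient.eq

theorem modFiniteRank_eq_of_eqOn {A B : H →L[𝕜] H} {M : Submodule 𝕜 H} (hM : M.CoFG)
    (h : ∀ x ∈ M, A x = B x) : modFiniteRank A = modFiniteRank B := by
  rw [modFiniteRank_eq_iff, ← LinearMap.ker_coFG_iff_hasFiniteRange]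
  exact hM.of_le fun x hx ↦ by simp [h x hx]

open scoped LinearMap.FiniteRangeSetoid in
theorem isFredholm_iff_isUnit {A : H →L[𝕜] H} :
    A.IsFredholm ↔ IsUnit (modFiniteRank A) := by
  have key (B C : H →L[𝕜] H) : B.toLinearMap ∘ₗ C.toLinearMap ≈ LinearMap.id ↔
      modFiniteRank B * modFiniteRank C = 1 := by
    rw [← map_mul, ← map_one modFiniteRank, modFiniteRank_eq_iff,
      LinearMap.FiniteRangeSetoid.equiv_iff_hasFiniteRange]
    rfl
  rw [isFredholm_iff_exists_isQuasiInverse]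
  constructor
  · rintro ⟨B, hB⟩
    exact ⟨⟨_, modFiniteRank B, (key _ _).1 hB.2, (key _ _).1 hB.1⟩, rfl⟩
  · intro h
    obtain ⟨b, hab, hba⟩ := isUnit_iff_exists.1 h
    obtain ⟨B, rfl⟩ := Ideal.Quotient.mk_surjective b
    exact ⟨B, (key _ _).2 hba, (key _ _).2 hab⟩

variable [CompleteSpace H]

/-- With Q the projection onto the finite-dimensional range, A = QA, so A* = A*Q. -/
theorem hasFiniteRange_adjoint {A : H →L[𝕜] H} (h : A.toLinearMap.HasFiniteRange) :
    (adjoint A).toLinearMap.HasFiniteRange := by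
  have : FiniteDimensional 𝕜 A.range := Module.Finite.iff_fg.2 h
  have hA : A.range.starProjection ∘L A = A := by
    ext x
    exact Submodule.starProjection_eq_self_iff.2 ⟨x, rfl⟩
  have hP : A.range.starProjection.toLinearMap.HasFiniteRange := by
    rw [LinearMap.hasFiniteRange_iff_range, Submodule.range_starProjection]
    exact h
  rw [← hA, adjoint_comp]
  have hs : adjoint A.range.starProjection = A.range.starProjection :=
    isSelfAdjoint_starProjection A.range
  rw [hs]
  exact hP.comp_left _

theorem modFiniteRank_adjoint_congr {A B : H →L[𝕜] H}
    (h : modFiniteRank A = modFiniteRank B) :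
    modFiniteRank (adjoint A) = modFiniteRank (adjoint B) := by
  rw [modFiniteRank_eq_iff] at h ⊢
  rw [← map_sub]
  exact hasFiniteRange_adjoint h

end FiniteRank

section SquareZero

variable {R : Type*} [Ring R] {u u' : R}

theorem add_mul_self_of_mul_self_eq_zero (hu : u * u = 0) (hu' : u' * u' = 0) :
    (u + u') * (u + u') = u * u' + u' * u := by
  simp only [add_mul, mul_add, hu, hu']
  abel

end SquareZero

/-! ### Inverting U + U* and UU* + U*U modulo finite rank -/

section Core

variable {𝕜 H : Type*} [RCLike 𝕜] [NormedAddCommGroup H] [InnerProductSpace 𝕜 H]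
  [CompleteSpace H]

theorem ker_le_range_sup_of_isUnit {U : H →L[𝕜] H} (hU : modFiniteRank U * modFiniteRank U = 0)
    (hD : IsUnit (modFiniteRank (U * adjoint U + adjoint U * U))) :
    ∃ F : Submodule 𝕜 H, F.FG ∧ U.ker ≤ U.range ⊔ F := by
  obtain ⟨e, hde, hed⟩ := isUnit_iff_exists.1 hD
  obtain ⟨E, rfl⟩ := Ideal.Quotient.mk_surjective e
  set d := modFiniteRank (U * adjoint U + adjoint U * U) with hd
  -- Both sides reduce to uu'u because u² = 0; hence e = d⁻¹ commutes with u as well.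
  have hcomm : modFiniteRank U * d = d * modFiniteRank U := by
    simp only [hd, map_add, map_mul, mul_add, add_mul, mul_assoc, hU]
    simp only [← mul_assoc, hU]
    simp
  have heu : modFiniteRank E * modFiniteRank U = modFiniteRank U * modFiniteRank E := by
    calc modFiniteRank E * modFiniteRank U
        = modFiniteRank E * (modFiniteRank U * d) * modFiniteRank E := by
          rw [mul_assoc, mul_assoc, hde, mul_one]
      _ = modFiniteRank U * modFiniteRank E := by
          rw [hcomm, ← mul_assoc, hed, one_mul]
  -- The homotopy formula 1 = ueu' + eu'u. Its second term vanishes on N(U), its first lands in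
  -- R(U), and the finite-rank error supplies F.
  have hF : modFiniteRank 1 = modFiniteRank
      (U * E * adjoint U + E * adjoint U * U) := by
    simp only [map_add, map_mul, map_one, ← heu]
    rw [← hed, hd]
    simp only [map_add, map_mul, mul_add, mul_assoc]
  refine ⟨_, (modFiniteRank_eq_iff.1 hF).fg_range, fun x hx ↦ ?_⟩
  have hx0 : U x = 0 := hx
  refine Submodule.mem_sup.2 ⟨U (E (adjoint U x)), ⟨_, rfl⟩, _, ⟨x, rfl⟩, ?_⟩
  simp [hx0]

/-- P is the projection onto N = N(U). W projects onto M = N ∩ R(U), then inverts U there with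
values in N⊥. -/
theorem exists_partial_inverse {U : H →L[𝕜] H} (hU : (U * U).toLinearMap.HasFiniteRange)
    {F : Submodule 𝕜 H} (hF : F.FG) (hN : U.ker ≤ U.range ⊔ F) :
    ∃ P W : H →L[𝕜] H, adjoint P = P ∧ U * P = 0 ∧ P * W = 0 ∧
      modFiniteRank U * modFiniteRank W = modFiniteRank P ∧
      modFiniteRank W * modFiniteRank U = 1 - modFiniteRank P ∧
      modFiniteRank W * modFiniteRank P = modFiniteRank W := by
  set N := U.ker
  have hNc : IsClosed (N : Set H) := U.isClosed_ker
  have : CompleteSpace N := hNc.completeSpace_coe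
  -- Intersecting with N(U²) makes U map K into N, injectively since K ⊆ N⊥.
  set K : Submodule 𝕜 H := Nᗮ ⊓ (U * U).ker
  have hKc : IsClosed (K : Set H) := N.isClosed_orthogonal.inter (U * U).isClosed_ker
  have : CompleteSpace K := hKc.completeSpace_coe
  let f : K →L[𝕜] N := (U ∘L K.subtypeL).codRestrict N fun x ↦ x.2.2
  have hUK : ∀ x ∈ K, U x = 0 → x = 0 := fun x hx h0 ↦
    inner_self_eq_zero.1 (hx.1 x h0)
  have hfinj : f.ker = ⊥ := by
    refine (Submodule.eq_bot_iff _).2 fun x hx ↦ Subtype.ext (hUK x x.2 ?_)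
    exact congrArg Subtype.val (show f x = 0 from hx)
  have split : ∀ x, x - N.starProjection x ∈ Nᗮ := N.sub_starProjection_mem_orthogonal
  have hUN : ∀ x, U (N.starProjection x) = 0 := fun x ↦ N.starProjection_apply_mem x
  have hfr : f.range = (N ⊓ U.range).submoduleOf N := by
    ext y
    constructor
    · rintro ⟨x, rfl⟩
      exact ⟨(f x).2, ⟨x, rfl⟩⟩
    · rintro ⟨-, x, hx⟩
      have hx : U x = y := hx
      refine ⟨⟨x - N.starProjection x, split x, ?_⟩, Subtype.ext ?_⟩
      · simp [hUN, hx]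
      · change U (x - N.starProjection x) = y
        rw [map_sub, hUN, sub_zero, hx]
  have hcofg : f.range.CoFG := by
    rw [hfr]
    exact (Submodule.finite_quotient_inf_iff _ _).2 ⟨F, hF, hN⟩
  obtain ⟨G, hG⟩ := Submodule.exists_isCompl f.range
  have : FiniteDimensional 𝕜 G := Module.Finite.iff_fg.2 (hcofg.fg_of_isCompl hG)
  -- A range with a finite-dimensional algebraic complement is closed, so the inverse of U on it is
  -- bounded.
  have hfc : IsClosed (f.range : Set N) :=
    f.closed_complemented_range_of_isCompl_of_ker_eq_bot G hG G.closed_of_finiteDimensional hfinj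
  let g : K →L[𝕜] H := N.subtypeL ∘L f
  have hgU : ∀ x, g x = U x := fun x ↦ rfl
  have hgc : IsClosed (Set.range g) := by
    have := hNc.isClosedEmbedding_subtypeVal.isClosedMap _ hfc
    rwa [LinearMap.coe_range, ← Set.range_comp] at this
  have hginj : Function.Injective g :=
    Subtype.val_injective.comp (LinearMap.ker_eq_bot.1 hfinj)
  set M := g.range with hM
  have hMc : IsClosed (M : Set H) := by rw [hM, LinearMap.coe_range]; exact hgc
  have : CompleteSpace M := hMc.completeSpace_coe
  let e : K ≃L[𝕜] M := g.equivRange hginj hgc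
  have he : ∀ m : M, U (e.symm m) = m := fun m ↦ by
    rw [← hgU]
    exact congrArg Subtype.val (e.apply_symm_apply m)
  let W : H →L[𝕜] H := K.subtypeL ∘L (e.symm : M →L[𝕜] K) ∘L M.orthogonalProjectionOnto
  have hWK : ∀ x, W x ∈ K := fun x ↦ (e.symm (M.orthogonalProjectionOnto x)).2
  have hUW : U * W = M.starProjection := by
    ext x
    exact he _
  have hMN : M ≤ N := by
    rintro _ ⟨x, rfl⟩
    exact (f x).2
  -- M has finite codimension in N, and both projections agree on M + N⊥.
  have hPN : modFiniteRank M.starProjection = modFiniteRank N.starProjection := by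
    have hlin : N ≤ M ⊔ G.map N.subtype := fun x hx ↦ by
      have hx' : (⟨x, hx⟩ : N) ∈ f.range ⊔ G := by simp [hG.sup_eq_top]
      obtain ⟨_, ⟨y, rfl⟩, z, hz, hyz⟩ := Submodule.mem_sup.1 hx'
      exact Submodule.mem_sup.2 ⟨g y, ⟨y, rfl⟩, z, Submodule.mem_map_of_mem hz,
        congrArg Subtype.val hyz⟩
    have hco : (M ⊔ Nᗮ).CoFG := by
      refine Submodule.FG.cofg_of_codisjoint (S := G.map N.subtype) ?_
        ((hcofg.fg_of_isCompl hG).map _)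
      rw [codisjoint_iff, eq_top_iff, ← Submodule.sup_orthogonal_of_hasOrthogonalProjection (K := N)]
      refine sup_le (hlin.trans ?_) (le_sup_of_le_right le_sup_right)
      exact sup_le (le_sup_of_le_right le_sup_left) le_sup_left
    refine modFiniteRank_eq_of_eqOn hco fun x hx ↦ ?_
    obtain ⟨y, hy, z, hz, rfl⟩ := Submodule.mem_sup.1 hx
    rw [map_add, map_add, Submodule.starProjection_eq_self_iff.2 hy,
      Submodule.starProjection_eq_self_iff.2 (hMN hy),
      (Submodule.starProjection_apply_eq_zero_iff _).2 hz,
      (Submodule.starProjection_apply_eq_zero_iff _).2 (Submodule.orthogonal_le hMN hz)]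
  refine ⟨N.starProjection, W, isSelfAdjoint_starProjection N, ?_, ?_, ?_, ?_, ?_⟩
  · ext x
    exact hUN x
  · ext x
    exact (Submodule.starProjection_apply_eq_zero_iff _).2 (hWK x).1
  · rw [← map_mul, hUW, hPN]
  · rw [← map_mul, ← map_one modFiniteRank, ← map_sub]
    -- It suffices to check on N(U²), of finite codimension: there x - Px lies in K, and W recovers
    -- it from Ux.
    refine modFiniteRank_eq_of_eqOn hU.cofg_ker fun x hx ↦ ?_
    have hx : U (U x) = 0 := hx
    have hk : x - N.starProjection x ∈ K := ⟨split x, by simp [hUN, hx]⟩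
    have hUx : U x = g ⟨_, hk⟩ := by simp [hgU, hUN]
    have hproj : M.orthogonalProjectionOnto (U x) = e ⟨_, hk⟩ := by
      rw [hUx]
      exact Submodule.orthogonalProjectionOnto_mem_subspace_eq_self (e ⟨_, hk⟩)
    simp [W, hproj]
  · rw [← hPN, ← map_mul]
    congr 1
    ext x
    have : M.orthogonalProjectionOnto (M.starProjection x) = M.orthogonalProjectionOnto x :=
      Submodule.orthogonalProjectionOnto_mem_subspace_eq_self _
    simp [W, this]

theorem isUnit_add_adjoint_of_ker_le {U : H →L[𝕜] H}
    (hU : (U * U).toLinearMap.HasFiniteRange)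
    {F : Submodule 𝕜 H} (hF : F.FG) (hN : U.ker ≤ U.range ⊔ F) :
    IsUnit (modFiniteRank (U + adjoint U)) := by
  obtain ⟨P, W, hP, hUP, hPW, huw, hwu, hwp⟩ := exists_partial_inverse hU hF hN
  have adj {A B C : H →L[𝕜] H} (h : modFiniteRank A * modFiniteRank B = modFiniteRank C) :
      modFiniteRank (adjoint B) * modFiniteRank (adjoint A) = modFiniteRank (adjoint C) := by
    rw [← map_mul] at h ⊢
    have := modFiniteRank_adjoint_congr h
    rwa [mul_def, adjoint_comp] at this
  have hup : modFiniteRank U * modFiniteRank P = modFiniteRank 0 := by rw [← map_mul, hUP]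
  have hpw : modFiniteRank P * modFiniteRank W = modFiniteRank 0 := by rw [← map_mul, hPW]
  have hwu' : modFiniteRank W * modFiniteRank U = modFiniteRank (1 - P) := by
    rw [hwu, map_sub, map_one]
  have a1 := adj hup
  have a2 := adj hpw
  have a3 := adj huw
  have a4 := adj hwu'
  have a5 := adj hwp
  have one_adj : adjoint (1 : H →L[𝕜] H) = 1 := adjoint_id
  simp only [hP, map_zero, map_sub, map_one, one_adj] at hup hpw a1 a2 a3 a4 a5
  have hpu : modFiniteRank P * modFiniteRank U = modFiniteRank U := by
    rw [← huw, mul_assoc, hwu, mul_sub, mul_one, hup, sub_zero]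
  have a6 := adj hpu
  rw [hP] at a6
  generalize modFiniteRank P = p at *
  generalize modFiniteRank W = w at *
  generalize modFiniteRank (adjoint W) = w' at *
  rw [map_add]
  generalize modFiniteRank U = u at *
  generalize modFiniteRank (adjoint U) = u' at *
  -- The cross terms vanish, leaving uw + u'w' = p + (1 - p) and wu + w'u' = (1 - p) + p.
  have b1 : u * w' = 0 := by rw [← a5, ← mul_assoc, hup, zero_mul]
  have b2 : u' * w = 0 := by rw [← a6, mul_assoc, hpw, mul_zero]
  have b3 : w * u' = 0 := by rw [← hwp, mul_assoc, a1, mul_zero]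
  have b4 : w' * u = 0 := by rw [← hpu, ← mul_assoc, a2, zero_mul]
  refine isUnit_iff_exists.2 ⟨w + w', ?_, ?_⟩
  · simp only [add_mul, mul_add, huw, b1, b2, a4]
    abel
  · simp only [add_mul, mul_add, hwu, b3, b4, a3]
    abel

end Core

/-! ### Fredholm operators and direct sums -/

section Decomposition

theorem LinearMap.HasFiniteRange.congr {K V V₂ : Type*} [Field K] [AddCommGroup V] [Module K V]
    [AddCommGroup V₂] [Module K V₂] {f g : V →ₗ[K] V₂} (hf : f.HasFiniteRange)
    (h : ∀ x, g x = f x) : g.HasFiniteRange :=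
  LinearMap.ext h ▸ hf

variable {𝕜 E E₁ E₂ : Type*} [RCLike 𝕜] [NormedAddCommGroup E] [NormedSpace 𝕜 E]
  [NormedAddCommGroup E₁] [NormedSpace 𝕜 E₁] [NormedAddCommGroup E₂] [NormedSpace 𝕜 E₂]

/-- If C is a quasi-inverse of D, its compression pCj is one of A. -/
theorem ContinuousLinearMap.IsFredholm.of_retract {D : E →L[𝕜] E} {A : E₁ →L[𝕜] E₁}
    {j : E₁ →L[𝕜] E} {p : E →L[𝕜] E₁} (hpj : ∀ x, p (j x) = x) (hj : ∀ x, D (j x) = j (A x))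
    (hp : ∀ x, p (D x) = A (p x)) (hD : D.IsFredholm) : A.IsFredholm := by
  obtain ⟨C, hCD, hDC⟩ := hD.exists_isQuasiInverse
  refine .of_isQuasiInverse (v := p ∘L C ∘L j) ⟨?_, ?_⟩
  · refine LinearMap.FiniteRangeSetoid.equiv_iff_hasFiniteRange.2 ?_
    have h := ((LinearMap.FiniteRangeSetoid.equiv_iff_hasFiniteRange.1 hCD).comp_left
      p.toLinearMap).comp_right j.toLinearMap
    refine h.congr fun x ↦ ?_
    simp [hpj, hj]
  · refine LinearMap.FiniteRangeSetoid.equiv_iff_hasFiniteRange.2 ?_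
    have h := ((LinearMap.FiniteRangeSetoid.equiv_iff_hasFiniteRange.1 hDC).comp_left
      p.toLinearMap).comp_right j.toLinearMap
    refine h.congr fun x ↦ ?_
    simp [hpj, hp]

theorem ContinuousLinearMap.IsFredholm.of_decomposition {D : E →L[𝕜] E}
    {A₁ : E₁ →L[𝕜] E₁} {A₂ : E₂ →L[𝕜] E₂} {j₁ : E₁ →L[𝕜] E} {j₂ : E₂ →L[𝕜] E}
    {p₁ : E →L[𝕜] E₁} {p₂ : E →L[𝕜] E₂} (hjp : ∀ x, j₁ (p₁ x) + j₂ (p₂ x) = x)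
    (hj₁ : ∀ x, D (j₁ x) = j₁ (A₁ x)) (hj₂ : ∀ x, D (j₂ x) = j₂ (A₂ x))
    (hp₁ : ∀ x, p₁ (D x) = A₁ (p₁ x)) (hp₂ : ∀ x, p₂ (D x) = A₂ (p₂ x))
    (h₁ : A₁.IsFredholm) (h₂ : A₂.IsFredholm) : D.IsFredholm := by
  obtain ⟨C₁, hCA₁, hAC₁⟩ := h₁.exists_isQuasiInverse
  obtain ⟨C₂, hCA₂, hAC₂⟩ := h₂.exists_isQuasiInverse
  have combine {B₁ : E₁ →ₗ[𝕜] E₁} {B₂ : E₂ →ₗ[𝕜] E₂} (hB₁ : (B₁ - .id).HasFiniteRange)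
      (hB₂ : (B₂ - .id).HasFiniteRange) : ((j₁.toLinearMap ∘ₗ B₁ ∘ₗ p₁.toLinearMap +
        j₂.toLinearMap ∘ₗ B₂ ∘ₗ p₂.toLinearMap) - LinearMap.id).HasFiniteRange := by
    have h := ((hB₁.comp_left j₁.toLinearMap).comp_right p₁.toLinearMap).add
      ((hB₂.comp_left j₂.toLinearMap).comp_right p₂.toLinearMap)
    refine h.congr fun x ↦ ?_
    simp only [LinearMap.sub_apply, LinearMap.add_apply, LinearMap.comp_apply, map_sub,
      LinearMap.id_apply]
    nth_rw 3 [← hjp x]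
    exact add_sub_add_comm _ _ _ _
  refine .of_isQuasiInverse (v := j₁ ∘L C₁ ∘L p₁ + j₂ ∘L C₂ ∘L p₂) ⟨?_, ?_⟩
  · refine LinearMap.FiniteRangeSetoid.equiv_iff_hasFiniteRange.2 ?_
    have h := combine (LinearMap.FiniteRangeSetoid.equiv_iff_hasFiniteRange.1 hCA₁)
      (LinearMap.FiniteRangeSetoid.equiv_iff_hasFiniteRange.1 hCA₂)
    refine h.congr fun x ↦ ?_
    simp [hp₁, hp₂]
  · refine LinearMap.FiniteRangeSetoid.equiv_iff_hasFiniteRange.2 ?_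
    have h := combine (LinearMap.FiniteRangeSetoid.equiv_iff_hasFiniteRange.1 hAC₁)
      (LinearMap.FiniteRangeSetoid.equiv_iff_hasFiniteRange.1 hAC₂)
    refine h.congr fun x ↦ ?_
    simp [hj₁, hj₂]

end Decomposition

/-! ### The operator matrix U -/

section OffDiag

variable {𝕜 H₁ H₂ : Type*} [RCLike 𝕜]
  [NormedAddCommGroup H₁] [InnerProductSpace 𝕜 H₁]
  [NormedAddCommGroup H₂] [InnerProductSpace 𝕜 H₂]

theorem isFredholm_iff_of_apply_toLp {D : WithLp 2 (H₁ × H₂) →L[𝕜] WithLp 2 (H₁ × H₂)}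
    {A₁ : H₁ →L[𝕜] H₁} {A₂ : H₂ →L[𝕜] H₂}
    (h : ∀ x y, D (WithLp.toLp 2 (x, y)) = WithLp.toLp 2 (A₁ x, A₂ y)) :
    D.IsFredholm ↔ A₁.IsFredholm ∧ A₂.IsFredholm := by
  let e := (WithLp.prodContinuousLinearEquiv 2 𝕜 H₁ H₂).symm.toContinuousLinearMap
  let j₁ := e ∘L ContinuousLinearMap.inl 𝕜 H₁ H₂
  let j₂ := e ∘L ContinuousLinearMap.inr 𝕜 H₁ H₂
  let p₁ := WithLp.fstL 2 𝕜 H₁ H₂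
  let p₂ := WithLp.sndL 2 𝕜 H₁ H₂
  have j₁_apply (x : H₁) : j₁ x = WithLp.toLp 2 (x, 0) := rfl
  have j₂_apply (y : H₂) : j₂ y = WithLp.toLp 2 (0, y) := rfl
  have hj₁ (x : H₁) : D (j₁ x) = j₁ (A₁ x) := by simp [j₁_apply, h]
  have hj₂ (y : H₂) : D (j₂ y) = j₂ (A₂ y) := by simp [j₂_apply, h]
  have hp₁ (z) : p₁ (D z) = A₁ (p₁ z) := congrArg p₁ (h z.fst z.snd)
  have hp₂ (z) : p₂ (D z) = A₂ (p₂ z) := congrArg p₂ (h z.fst z.snd)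
  refine ⟨fun hD ↦ ⟨hD.of_retract (j := j₁) (p := p₁) (fun _ ↦ rfl) hj₁ hp₁,
    hD.of_retract (j := j₂) (p := p₂) (fun _ ↦ rfl) hj₂ hp₂⟩,
    fun hA ↦ .of_decomposition (fun z ↦ ?_) hj₁ hj₂ hp₁ hp₂ hA.1 hA.2⟩
  rw [j₁_apply, j₂_apply, ← WithLp.toLp_add, Prod.mk_add_mk, add_zero, zero_add]
  rfl

theorem adjoint_offDiag [CompleteSpace H₁] [CompleteSpace H₂]
    (S : H₁ →L[𝕜] H₂) (T : H₂ →L[𝕜] H₁) :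
    adjoint (offDiag S T) = offDiag (adjoint T) (adjoint S) := by
  refine ((eq_adjoint_iff _ _).2 fun z w ↦ ?_).symm
  obtain ⟨x, y⟩ := z
  obtain ⟨x', y'⟩ := w
  simp only [offDiag_apply, WithLp.prod_inner_apply, adjoint_inner_left]
  exact add_comm _ _

theorem hasFiniteRange_offDiag_mul_self {S : H₁ →L[𝕜] H₂} {T : H₂ →L[𝕜] H₁}
    (hTS : FiniteDimensional 𝕜 (T ∘L S).range) (hST : FiniteDimensional 𝕜 (S ∘L T).range) :
    (offDiag S T * offDiag S T).toLinearMap.HasFiniteRange := by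
  let e := (WithLp.prodContinuousLinearEquiv 2 𝕜 H₁ H₂).symm.toLinearMap
  have hfg : (((T ∘L S).range.prod (S ∘L T).range).map e).FG :=
    ((Module.Finite.iff_fg.1 hTS).prod (Module.Finite.iff_fg.1 hST)).map e
  have := Module.Finite.iff_fg.2 hfg
  refine Module.Finite.iff_fg.1 (Submodule.finiteDimensional_of_le
    (S₂ := ((T ∘L S).range.prod (S ∘L T).range).map e) ?_)
  rintro _ ⟨z, rfl⟩
  exact ⟨(T (S z.fst), S (T z.snd)), ⟨⟨_, rfl⟩, ⟨_, rfl⟩⟩, rfl⟩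

theorem isFredholmPair_iff {S : H₁ →L[𝕜] H₂} {T : H₂ →L[𝕜] H₁}
    (hTS : FiniteDimensional 𝕜 (T ∘L S).range) (hST : FiniteDimensional 𝕜 (S ∘L T).range) :
    IsFredholmPair S T ↔ ∃ F : Submodule 𝕜 (WithLp 2 (H₁ × H₂)),
      F.FG ∧ (offDiag S T).ker ≤ (offDiag S T).range ⊔ F := by
  constructor
  · intro h
    obtain ⟨F₁, hF₁, hS⟩ := (Submodule.finite_quotient_inf_iff _ _).1 h.finite_ker_fst
    obtain ⟨F₂, hF₂, hT⟩ := (Submodule.finite_quotient_inf_iff _ _).1 h.finite_ker_snd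
    refine ⟨(F₁.prod F₂).map (WithLp.prodContinuousLinearEquiv 2 𝕜 H₁ H₂).symm.toLinearMap,
      (hF₁.prod hF₂).map _, ?_⟩
    rintro ⟨x, y⟩ hz
    have hz : WithLp.toLp 2 (T y, S x) = 0 := hz
    obtain ⟨_, ⟨a, rfl⟩, f₁, hf₁, hx⟩ := Submodule.mem_sup.1
      (hS (show S x = 0 from congrArg WithLp.snd hz))
    obtain ⟨_, ⟨b, rfl⟩, f₂, hf₂, hy⟩ := Submodule.mem_sup.1
      (hT (show T y = 0 from congrArg WithLp.fst hz))
    refine Submodule.mem_sup.2 ⟨_, ⟨WithLp.toLp 2 (b, a), rfl⟩, _,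
      ⟨(f₁, f₂), ⟨hf₁, hf₂⟩, rfl⟩, ?_⟩
    rw [← hx, ← hy]
    rfl
  · rintro ⟨F, hF, h⟩
    refine ⟨(Submodule.finite_quotient_inf_iff _ _).2
        ⟨F.map (WithLp.fstL 2 𝕜 H₁ H₂).toLinearMap, hF.map _, fun x hx ↦ ?_⟩, ?_,
      (Submodule.finite_quotient_inf_iff _ _).2
        ⟨F.map (WithLp.sndL 2 𝕜 H₁ H₂).toLinearMap, hF.map _, fun y hy ↦ ?_⟩, ?_⟩
    · have hx : S x = 0 := hx
      have hz : WithLp.toLp 2 (x, (0 : H₂)) ∈ (offDiag S T).ker := by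
        simp [offDiag_apply, hx]
      obtain ⟨_, ⟨w, rfl⟩, f, hf, hwf⟩ := Submodule.mem_sup.1 (h hz)
      exact Submodule.mem_sup.2 ⟨T w.snd, ⟨_, rfl⟩, _, ⟨f, hf, rfl⟩, congrArg WithLp.fst hwf⟩
    · refine S.toLinearMap.finite_quotient_ker_inf _ ?_
      rw [← LinearMap.range_comp]
      exact hST
    · have hy : T y = 0 := hy
      have hz : WithLp.toLp 2 ((0 : H₁), y) ∈ (offDiag S T).ker := by
        simp [offDiag_apply, hy]
      obtain ⟨_, ⟨w, rfl⟩, f, hf, hwf⟩ := Submodule.mem_sup.1 (h hz)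
      exact Submodule.mem_sup.2 ⟨S w.fst, ⟨_, rfl⟩, _, ⟨f, hf, rfl⟩, congrArg WithLp.snd hwf⟩
    · refine T.toLinearMap.finite_quotient_ker_inf _ ?_
      rw [← LinearMap.range_comp]
      exact hTS

end OffDiag


open ContinuousLinearMap in
theorem theorem3p5 {𝕜 H₁ H₂ : Type*} [RCLike 𝕜]
    [NormedAddCommGroup H₁] [InnerProductSpace 𝕜 H₁] [CompleteSpace H₁]
    [NormedAddCommGroup H₂] [InnerProductSpace 𝕜 H₂] [CompleteSpace H₂]
    (S : H₁ →L[𝕜] H₂) (T : H₂ →L[𝕜] H₁)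
    (hTS : FiniteDimensional 𝕜 (T ∘L S).range)
    (hST : FiniteDimensional 𝕜 (S ∘L T).range)
    (U V : WithLp 2 (H₁ × H₂) →L[𝕜] WithLp 2 (H₁ × H₂))
    (hU : U = offDiag S T) (hV : V = U + adjoint U) :
    List.TFAE [
      IsFredholmPair S T,
      V.IsFredholm,
      (V ∘L V).IsFredholm,
      (U ∘L adjoint U + adjoint U ∘L U).IsFredholm,
      (T ∘L adjoint T + adjoint S ∘L S).IsFredholm ∧
        (S ∘L adjoint S + adjoint T ∘L T).IsFredholm] := by
  have hfin : (U * U).toLinearMap.HasFiniteRange := by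
    rw [hU]
    exact hasFiniteRange_offDiag_mul_self hTS hST
  have huu : modFiniteRank U * modFiniteRank U = 0 := by
    rw [← map_mul]
    exact Ideal.Quotient.eq_zero_iff_mem.2 hfin
  have huu' : modFiniteRank (adjoint U) * modFiniteRank (adjoint U) = 0 := by
    rw [← map_mul, mul_def, ← adjoint_comp]
    exact Ideal.Quotient.eq_zero_iff_mem.2 (hasFiniteRange_adjoint hfin)
  have hsq : modFiniteRank (V * V) = modFiniteRank (U * adjoint U + adjoint U * U) := by
    simp only [hV, map_mul, map_add]
    exact add_mul_self_of_mul_self_eq_zero huu huu'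
  have hVV : (V ∘L V).IsFredholm ↔ V.IsFredholm := by
    rw [← mul_def, isFredholm_iff_isUnit, isFredholm_iff_isUnit, map_mul, isUnit_mul_self_iff]
  have hVU : (V ∘L V).IsFredholm ↔ (U ∘L adjoint U + adjoint U ∘L U).IsFredholm := by
    rw [← mul_def, isFredholm_iff_isUnit, isFredholm_iff_isUnit, hsq]
    rfl
  tfae_have 1 → 2 := by
    intro h
    obtain ⟨F, hF, hN⟩ := (isFredholmPair_iff hTS hST).1 h
    rw [← hU] at hN
    rw [hV, isFredholm_iff_isUnit]
    exact isUnit_add_adjoint_of_ker_le hfin hF hN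
  tfae_have 2 ↔ 3 := hVV.symm
  tfae_have 3 ↔ 4 := hVU
  tfae_have 4 → 1 := by
    intro h
    rw [isFredholmPair_iff hTS hST, ← hU]
    exact ker_le_range_sup_of_isUnit huu (isFredholm_iff_isUnit.1 h)
  tfae_have 4 ↔ 5 := by
    refine isFredholm_iff_of_apply_toLp fun x y ↦ ?_
    rw [hU, adjoint_offDiag]
    simp only [add_apply, ContinuousLinearMap.comp_apply, offDiag_apply,
      ← WithLp.toLp_add, Prod.mk_add_mk]
  tfae_finish
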